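/- There are universal constants $c,C,\tilde\gamma_1,\tilde\gamma_2>0$ such that the following holds for all sufficiently large $n$ and all integers $k$ with $1\le k\le n/32$. Let $v\in\mathbb R^n$ be nonzero, let $i^*\in\arg\max_i|v(i)|$, let $\tilde v_1,\dots,\tilde v_k$ be independent $N(0,I_n)$ random vectors, and let $W=\operatorname{span}\{v,\tilde v_1,\dots,\tilde v_k\}$. For an integer $s$, let $v_s$ denote a best $s$-term approximation of $v$, that is, a minimizer of $\|v-u\|_1$ over all $u$ with at most $s$ nonzero entries. Consider the program $$\min\|z\|_1\quad\text{such that } z\in W,\ z(i^*)=1. \tag{P}$$ (a) For $s=\left\lfloor c\,\frac{n/\sqrt{\log n}}{\sqrt k}\right\rfloor$, with probability at least $1-\tilde\gamma_1e^{-\tilde\gamma_2n/2}-k\,e^{-\lfloor c\sqrt{n/\log n}\rfloor}-k/n^2$, every minimizer $z^\#$ of (P) satisfies $$\left\|z^\#-\frac{v}{v(i^*)}\right\|_2\le C\,\frac{\sqrt{k\log n}}{\sqrt n}\,\frac{\|v-v_s\|_1}{\|v\|_\infty}.$$ (b) More generally, for every integer $s$ with $1\le s\le c\,\frac{n/\sqrt{\log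 n}}{\sqrt k}$, with probability at least $1-\tilde\gamma_1e^{-\tilde\gamma_2n}-k\,e^{-s}-k/n^2$, every minimizer $z^\#$ of (P) satisfies $$\left\|z^\#-\frac{v}{v(i^*)}\right\|_2\le C\,\frac{\sqrt n}{s}\,\frac{\|v-v_s\|_1}{\|v\|_\infty}.$$ The constants $c,C,\tilde\gamma_1,\tilde\gamma_2$ and the threshold for $n$ do not depend on $k$, $s$, $v$ or $i^*$. -/

import Mathlib

open MeasureTheory ProbabilityTheory

namespace PlantedSparse

/-- The `ℓ¹` norm on `ℝⁿ`. -/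
def l1 {n : ℕ} (z : EuclideanSpace ℝ (Fin n)) : ℝ := ∑ i, |z i|

/-- The `ℓ^∞` norm on `ℝⁿ` (the norm of the underlying function is the sup norm). -/
noncomputable def linf {n : ℕ} (z : EuclideanSpace ℝ (Fin n)) : ℝ := ‖WithLp.ofLp z‖

/-- The number of nonzero entries of a vector. -/
noncomputable def l0 {n : ℕ} (z : EuclideanSpace ℝ (Fin n)) : ℕ := {i | z i ≠ 0}.ncard

/-- `u` is a best `s`-term approximation of `v`: it has at most `s` nonzero entries and no other
vector with at most `s` nonzero entries is closer to `v` (in `ℓ¹`). -/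
def IsBestTermApprox {n : ℕ} (s : ℕ) (v u : EuclideanSpace ℝ (Fin n)) : Prop :=
  l0 u ≤ s ∧ ∀ u' : EuclideanSpace ℝ (Fin n), l0 u' ≤ s → l1 (v - u) ≤ l1 (v - u')

/-- The subspace spanned by the planted vector `v` and the vectors `w₁, …, w_k`. -/
def plantedSubspace {n k : ℕ} (v : EuclideanSpace ℝ (Fin n))
    (w : Fin k → EuclideanSpace ℝ (Fin n)) : Submodule ℝ (EuclideanSpace ℝ (Fin n)) :=
  Submodule.span ℝ (insert v (Set.range w))

/-- `z` is a minimizer of the program `min ‖z‖₁` subject to `z ∈ W`, `z i = 1`. -/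
def IsProgramMinimizer {n : ℕ} (W : Submodule ℝ (EuclideanSpace ℝ (Fin n))) (i : Fin n)
    (z : EuclideanSpace ℝ (Fin n)) : Prop :=
  (z ∈ W ∧ z i = 1) ∧ ∀ y ∈ W, y i = 1 → l1 z ≤ l1 y

/-- The event `A` holds with probability at least `p`. As `A` is not assumed to be measurable, this
asks for a measurable event of probability at least `p` on which `A` holds. -/
def HoldsWithProbAtLeast {Ω : Type*} [MeasurableSpace Ω] (P : Measure Ω) (p : ℝ) (A : Ω → Prop) :
    Prop :=
  ∃ E : Set Ω, MeasurableSet E ∧ p ≤ P.real E ∧ ∀ ω ∈ E, A ω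

end PlantedSparse

/-! ### Chernoff bounds for sums of absolute values of Gaussian coordinates -/

namespace PlantedSparse

/-! Put x = v / v(i*), and let σ be the `l1` mass of x outside a set S of at most s indices. Two
events suffice. On the first, of failure probability at most 1204 exp(-n), ‖∑ a_j w_j + b x‖₁ ≥
(n/100)‖a‖ for all a and b (`measureReal_exists_l1_lt_le`, by Chernoff bounds on a net). On the
second, of failure probability at most k/n², all Gaussian entries are below 3√(log n)
(`measureReal_exists_abs_apply_ge_le`).

The rest is deterministic (`norm_sub_le_of_isProgramMinimizer`). The constraint forces h = z - x to
be g - g(i*) x with g = ∑ a_j w_j, so every entry of h is at most 6√(k log n)‖a‖. As ‖z‖₁ ≤ ‖x‖₁,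
the cone condition `l1_le_of_l1_add_le` gives ‖h‖₁ ≤ 2‖h_S‖₁ + 2σ. For small s the first term is at
most half of the lower bound (n/100)‖a‖, whence ‖a‖ ≤ 400σ/n, and the entrywise bound on h yields
the `ℓ²` estimate. Part (b) weakens it by s√(k log n) ≤ n; the terms k exp(-s) in the probabilities
are slack. -/

lemma integrable_exp_mul_abs_gaussianReal (t : ℝ) :
    Integrable (fun x : ℝ => Real.exp (t * |x|)) (gaussianReal 0 1) :=
  integrable_exp_mul_abs (X := fun x : ℝ => x) (integrable_exp_mul_gaussianReal t)
    (integrable_exp_mul_gaussianReal (-t))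

lemma mgf_abs_gaussianReal_le (t : ℝ) :
    mgf (fun x : ℝ => |x|) (gaussianReal 0 1) t ≤ 2 * Real.exp (t ^ 2 / 2) := by
  have h (s : ℝ) : ∫ x, Real.exp (s * x) ∂(gaussianReal 0 1) = Real.exp (s ^ 2 / 2) := by
    simpa [mgf] using congrFun (mgf_fun_id_gaussianReal (μ := 0) (v := 1)) s
  calc mgf (fun x : ℝ => |x|) (gaussianReal 0 1) t
      ≤ ∫ x, (Real.exp (t * x) + Real.exp (-t * x)) ∂(gaussianReal 0 1) := by
        refine integral_mono (integrable_exp_mul_abs_gaussianReal t)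
          ((integrable_exp_mul_gaussianReal t).add (integrable_exp_mul_gaussianReal (-t)))
          fun x => ?_
        rcases abs_cases x with ⟨h, -⟩ | ⟨h, -⟩ <;> simp only [h]
        · linarith [Real.exp_pos (-t * x)]
        · rw [show t * -x = -t * x by ring]
          linarith [Real.exp_pos (t * x)]
    _ = 2 * Real.exp (t ^ 2 / 2) := by
        rw [integral_add (integrable_exp_mul_gaussianReal t)
          (integrable_exp_mul_gaussianReal (-t)), h, h]
        ring_nf

lemma integrable_exp_neg_mul_abs_add {μ : Measure ℝ} [IsFiniteMeasure μ] {l : ℝ} (hl : 0 ≤ l)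
    (u : ℝ) : Integrable (fun x : ℝ => Real.exp (-l * |x + u|)) μ := by
  refine Integrable.of_bound (C := 1) (by fun_prop) (ae_of_all _ fun x => ?_)
  rw [Real.norm_eq_abs, Real.abs_exp, Real.exp_le_one_iff]
  nlinarith [abs_nonneg (x + u)]

/-- The Gaussian density is at most 1/2, and the remaining Lebesgue integral is translation
invariant. Uniformity in `u` is what later permits arbitrary multiples of the planted vector. -/
lemma mgf_neg_abs_add_gaussianReal_le {l : ℝ} (hl : 0 < l) (u : ℝ) :
    mgf (fun x : ℝ => |x + u|) (gaussianReal 0 1) (-l) ≤ 1 / l := by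
  have hpdf (x : ℝ) : gaussianPDFReal 0 1 x ≤ 1 / 2 := by
    have h2 : (2 : ℝ) ≤ √(2 * Real.pi) :=
      Real.le_sqrt_of_sq_le (by nlinarith [Real.pi_gt_three])
    rw [gaussianPDFReal_def]
    simp only [NNReal.coe_one, mul_one, sub_zero]
    have h1 : Real.exp (-x ^ 2 / 2) ≤ 1 := Real.exp_le_one_iff.2 (by nlinarith [sq_nonneg x])
    have h3 : (√(2 * Real.pi))⁻¹ ≤ 1 / 2 := by
      rw [one_div]; exact inv_anti₀ (by norm_num) h2
    calc _ ≤ (1 / 2 : ℝ) * 1 := by gcongr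
      _ = _ := by ring
  have hv : ∫ x : ℝ, Real.exp (-l * |x|) = 2 / l := by
    rw [integral_comp_abs (f := fun x => Real.exp (-l * x)),
      integral_exp_mul_Ioi (by linarith)]
    simp
    field_simp
  have hi : Integrable (fun x : ℝ => Real.exp (-l * |x|)) :=
    Integrable.of_integral_ne_zero (by rw [hv]; positivity)
  rw [mgf, integral_gaussianReal_eq_integral_smul (by norm_num)]
  calc ∫ x, gaussianPDFReal 0 1 x • Real.exp (-l * |x + u|)
      ≤ ∫ x, (1 / 2 : ℝ) * Real.exp (-l * |x + u|) := by
        refine integral_mono_of_nonneg (ae_of_all _ fun x => ?_)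
          ((hi.comp_add_right u).const_mul _) (ae_of_all _ fun x => ?_)
        · exact mul_nonneg (gaussianPDFReal_nonneg _ _ _) (Real.exp_pos _).le
        · exact mul_le_mul_of_nonneg_right (hpdf x) (Real.exp_pos _).le
    _ = 1 / l := by
        rw [integral_const_mul, integral_add_right_eq_self (fun x => Real.exp (-l * |x|)), hv]
        ring

variable {n : ℕ}

lemma hasLaw_ofLp_stdGaussian :
    HasLaw (fun x : EuclideanSpace ℝ (Fin n) => fun i => x i)
      (Measure.pi fun _ => gaussianReal 0 1) (stdGaussian (EuclideanSpace ℝ (Fin n))) where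
  aemeasurable := by fun_prop
  map_eq := by
    rw [← map_pi_eq_stdGaussian, Measure.map_map (by fun_prop) (by fun_prop)]
    exact Measure.map_id

lemma hasLaw_apply_stdGaussian (i : Fin n) :
    HasLaw (fun x : EuclideanSpace ℝ (Fin n) => x i) (gaussianReal 0 1)
      (stdGaussian (EuclideanSpace ℝ (Fin n))) :=
  ((measurePreserving_eval (fun _ : Fin n => gaussianReal 0 1) i).hasLaw).comp
    hasLaw_ofLp_stdGaussian

lemma iIndepFun_apply_stdGaussian :
    iIndepFun (fun (i : Fin n) (x : EuclideanSpace ℝ (Fin n)) => x i)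
      (stdGaussian (EuclideanSpace ℝ (Fin n))) :=
  (iIndepFun_iff_hasLaw_pi_pi hasLaw_apply_stdGaussian).2 hasLaw_ofLp_stdGaussian

/-- The moment generating function of a sum of functions of the coordinates of a standard
Gaussian vector. -/
lemma integrable_mgf_sum_stdGaussian_le {t b : ℝ} {f : Fin n → ℝ → ℝ} (S : Finset (Fin n))
    (hf : ∀ i, Measurable (f i))
    (hi : ∀ i, Integrable (fun x => Real.exp (t * f i x)) (gaussianReal 0 1))
    (hb : ∀ i, mgf (f i) (gaussianReal 0 1) t ≤ b) :
    Integrable (fun x : EuclideanSpace ℝ (Fin n) => Real.exp (t * ∑ i ∈ S, f i (x i)))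
      (stdGaussian _) ∧
    mgf (fun x : EuclideanSpace ℝ (Fin n) => ∑ i ∈ S, f i (x i)) (stdGaussian _) t
      ≤ b ^ S.card := by
  have hind : iIndepFun (fun (i : Fin n) (x : EuclideanSpace ℝ (Fin n)) => f i (x i))
      (stdGaussian _) := iIndepFun_apply_stdGaussian.comp f hf
  have hm : ∀ i, Measurable fun x : EuclideanSpace ℝ (Fin n) => f i (x i) :=
    fun i => (hf i).comp (by fun_prop)
  have he : (fun x : EuclideanSpace ℝ (Fin n) => ∑ i ∈ S, f i (x i))
      = ∑ i ∈ S, fun x : EuclideanSpace ℝ (Fin n) => f i (x i) := by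
    ext x; simp
  have hlaw (i : Fin n) := (hasLaw_apply_stdGaussian i).map_eq
  constructor
  · have := hind.integrable_exp_mul_sum (t := t) hm (s := S) fun i _ => by
      have := hi i
      rw [← hlaw i] at this
      exact this.comp_aemeasurable (hasLaw_apply_stdGaussian i).aemeasurable
    simpa using this
  · rw [he, hind.mgf_sum hm]
    refine (Finset.prod_le_prod (fun i _ => mgf_nonneg) fun i _ => ?_).trans
      (Finset.prod_const b).le
    have h := hb i
    rw [← hlaw i, mgf_map (hasLaw_apply_stdGaussian i).aemeasurable
      (Measurable.aestronglyMeasurable (by have := hf i; fun_prop))] at h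
    exact h

lemma stdGaussian_real_le_sum_abs (S : Finset (Fin n)) {t : ℝ} (ht : 0 ≤ t) (r : ℝ) :
    (stdGaussian (EuclideanSpace ℝ (Fin n))).real {x | r ≤ ∑ i ∈ S, |x i|}
      ≤ Real.exp (-t * r) * (2 * Real.exp (t ^ 2 / 2)) ^ S.card := by
  obtain ⟨h1, h2⟩ := integrable_mgf_sum_stdGaussian_le (f := fun _ x => |x|) S
    (fun _ => by fun_prop) (fun _ => integrable_exp_mul_abs_gaussianReal t)
    (fun _ => mgf_abs_gaussianReal_le t)
  exact (measure_ge_le_exp_mul_mgf r ht h1).trans (by gcongr)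

lemma stdGaussian_real_sum_abs_add_le (u : Fin n → ℝ) {l : ℝ} (hl : 0 < l) (r : ℝ) :
    (stdGaussian (EuclideanSpace ℝ (Fin n))).real {x | ∑ i, |x i + u i| ≤ r}
      ≤ Real.exp (l * r) * (1 / l) ^ n := by
  obtain ⟨h1, h2⟩ := integrable_mgf_sum_stdGaussian_le (f := fun i x => |x + u i|) Finset.univ
    (fun _ => by fun_prop) (fun i => integrable_exp_neg_mul_abs_add hl.le (u i))
    (fun i => mgf_neg_abs_add_gaussianReal_le hl (u i))
  refine (measure_le_le_exp_mul_mgf r (by linarith) h1).trans ?_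
  rw [neg_neg]
  simp only [Finset.card_univ, Fintype.card_fin] at h2
  gcongr

/-- A linear combination of independent standard Gaussian vectors with a unit coefficient vector
is a standard Gaussian vector. -/
lemma hasLaw_sum_smul_stdGaussian {Ω : Type*} [MeasurableSpace Ω] {P : Measure Ω} {k : ℕ}
    {E : Type*} [NormedAddCommGroup E] [InnerProductSpace ℝ E]
    [FiniteDimensional ℝ E] [MeasurableSpace E] [BorelSpace E]
    [IsProbabilityMeasure P] {w : Fin k → Ω → E}
    (hw : ∀ j, HasLaw (w j) (stdGaussian E) P) (hind : iIndepFun w P)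
    (a : EuclideanSpace ℝ (Fin k)) (ha : ‖a‖ = 1) :
    HasLaw (fun ω => ∑ j, a j • w j ω) (stdGaussian E) P where
  aemeasurable := by
    have := fun j => (hw j).aemeasurable
    fun_prop
  map_eq := by
    have := FiniteDimensional.proper_real E
    have hm := fun j => (hw j).aemeasurable
    have hP : IsProbabilityMeasure (P.map fun ω => ∑ j, a j • w j ω) :=
      Measure.isProbabilityMeasure_map (by fun_prop)
    refine Measure.ext_of_charFun ?_
    ext t
    rw [(hind.comp (fun j x => a j • x) fun j => by fun_prop).charFun_map_fun_sum_eq_prod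
      (X := fun j ω => a j • w j ω) (fun j => by fun_prop)]
    rw [Finset.prod_apply]
    -- The exponents carry weights (a j)², which sum to 1.
    have h (j : Fin k) : charFun (P.map fun ω => a j • w j ω) t
        = Complex.exp (-((a j) ^ 2 * ‖t‖ ^ 2) / 2) := by
      rw [charFun_map_smul_comp (hm j), (hw j).map_eq, charFun_stdGaussian, norm_smul,
        ← Complex.ofReal_pow, mul_pow, Real.norm_eq_abs, sq_abs]
      push_cast
      rfl
    have hsum : ∑ j, a j ^ 2 = 1 := by
      have := EuclideanSpace.norm_sq_eq a
      simpa [ha] using this.symm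
    rw [Finset.prod_congr rfl fun j _ => h j, ← Complex.exp_sum, charFun_stdGaussian,
      ← Finset.sum_div, Finset.sum_neg_distrib, ← Finset.sum_mul]
    norm_cast
    rw [hsum, one_mul]

end PlantedSparse

/-! ### Nets of the sphere and the uniform `ℓ¹` lower bound -/

namespace PlantedSparse

section Net

variable {E : Type*} [NormedAddCommGroup E] [NormedSpace ℝ E] [FiniteDimensional ℝ E]

/-- Volumetric bound on the cardinality of a separated subset of the unit ball. -/
lemma card_le_of_separated_of_norm_le_one {ε : ℝ} (hε : 0 < ε) (s : Finset E)
    (hs : ∀ c ∈ s, ‖c‖ ≤ 1) (h : ∀ c ∈ s, ∀ d ∈ s, c ≠ d → ε ≤ ‖c - d‖) :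
    (s.card : ℝ) ≤ (1 + 2 / ε) ^ Module.finrank ℝ E := by
  borelize E
  let μ : Measure E := Measure.addHaar
  have hδ : 0 < ε / 2 := by positivity
  have hρ : 0 < 1 + ε / 2 := by positivity
  have hD : Set.Pairwise (s : Set E)
      (Function.onFun Disjoint fun c => Metric.ball (c : E) (ε / 2)) := by
    rintro c hc d hd hcd
    apply Metric.ball_disjoint_ball
    rw [dist_eq_norm]
    linarith [h c hc d hd hcd]
  have hsub : ⋃ c ∈ s, Metric.ball (c : E) (ε / 2) ⊆ Metric.ball (0 : E) (1 + ε / 2) := by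
    refine Set.iUnion₂_subset fun x hx => Metric.ball_subset_ball' ?_
    rw [dist_zero_right]
    linarith [hs x hx]
  have hI : (s.card : ENNReal) * ENNReal.ofReal ((ε / 2) ^ Module.finrank ℝ E) *
      μ (Metric.ball 0 1) ≤
      ENNReal.ofReal ((1 + ε / 2) ^ Module.finrank ℝ E) * μ (Metric.ball 0 1) :=
    calc
      _ = μ (⋃ c ∈ s, Metric.ball (c : E) (ε / 2)) := by
        rw [measure_biUnion_finset hD fun c _ => measurableSet_ball]
        simp only [μ.addHaar_ball_of_pos _ hδ]
        simp only [Finset.sum_const, nsmul_eq_mul, mul_assoc]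
      _ ≤ μ (Metric.ball (0 : E) (1 + ε / 2)) := measure_mono hsub
      _ = _ := by simp only [μ.addHaar_ball_of_pos _ hρ]
  have hJ := (ENNReal.mul_le_mul_iff_left (Metric.measure_ball_pos _ _ zero_lt_one).ne'
    measure_ball_lt_top.ne).1 hI
  have hK := ENNReal.toReal_le_of_le_ofReal (pow_nonneg hρ.le _) hJ
  rw [ENNReal.toReal_mul, ENNReal.toReal_natCast, ENNReal.toReal_ofReal (by positivity)] at hK
  rw [show 1 + 2 / ε = (1 + ε / 2) / (ε / 2) by field_simp; ring, div_pow]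
  exact (le_div_iff₀ (by positivity)).2 hK

/-- The unit sphere has an `ε`-net of size at most `(1 + 2 / ε) ^ dim`. -/
lemma exists_sphere_net {ε : ℝ} (hε : 0 < ε) :
    ∃ T : Finset E, (∀ c ∈ T, ‖c‖ = 1) ∧ (T.card : ℝ) ≤ (1 + 2 / ε) ^ Module.finrank ℝ E ∧
      ∀ x : E, ‖x‖ = 1 → ∃ c ∈ T, ‖x - c‖ ≤ ε := by
  classical
  -- A separated set of maximal cardinality is a net: an uncovered point could be added to it.
  let A : Set ℕ := {m | ∃ T : Finset E, (∀ c ∈ T, ‖c‖ = 1) ∧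
    (∀ c ∈ T, ∀ d ∈ T, c ≠ d → ε ≤ ‖c - d‖) ∧ T.card = m}
  have hA : A.Nonempty := ⟨0, ∅, by simp⟩
  have hbd : BddAbove A := by
    refine ⟨⌊(1 + 2 / ε) ^ Module.finrank ℝ E⌋₊, ?_⟩
    rintro m ⟨T, h1, h2, rfl⟩
    exact Nat.le_floor (card_le_of_separated_of_norm_le_one hε T (fun c hc => (h1 c hc).le) h2)
  obtain ⟨T, h1, h2, h3⟩ := Nat.sSup_mem hA hbd
  refine ⟨T, h1, card_le_of_separated_of_norm_le_one hε T (fun c hc => (h1 c hc).le) h2, ?_⟩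
  intro x hx
  by_contra! hcon
  have hxT : x ∉ T := fun hxT => by
    have := hcon x hxT
    rw [sub_self, norm_zero] at this
    exact this.not_gt hε
  have : (insert x T).card ≤ sSup A := by
    refine le_csSup hbd ⟨insert x T, ?_, ?_, rfl⟩
    · intro c hc
      rcases Finset.mem_insert.1 hc with rfl | hc
      · exact hx
      · exact h1 c hc
    · intro c hc d hd hcd
      rcases Finset.mem_insert.1 hc with hc' | hc' <;>
        rcases Finset.mem_insert.1 hd with hd' | hd'
      · exact absurd (hc'.trans hd'.symm) hcd
      · rw [hc']; exact (hcon d hd').le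
      · rw [hd', norm_sub_rev]; exact (hcon c hc').le
      · exact h2 c hc' d hd' hcd
  rw [Finset.card_insert_of_notMem hxT] at this
  omega

end Net

variable {n k : ℕ}

lemma l1_nonneg (z : EuclideanSpace ℝ (Fin n)) : 0 ≤ l1 z :=
  Finset.sum_nonneg fun _ _ => abs_nonneg _

lemma l1_add_le (y z : EuclideanSpace ℝ (Fin n)) : l1 (y + z) ≤ l1 y + l1 z := by
  simp only [l1, ← Finset.sum_add_distrib]
  exact Finset.sum_le_sum fun i _ => abs_add_le _ _

lemma l1_smul (c : ℝ) (z : EuclideanSpace ℝ (Fin n)) : l1 (c • z) = |c| * l1 z := by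
  simp [l1, Finset.mul_sum, abs_mul]

lemma l1_sub_le (y z : EuclideanSpace ℝ (Fin n)) : l1 (y - z) ≤ l1 y + l1 z := by
  have h := l1_add_le y ((-1 : ℝ) • z)
  rw [l1_smul] at h
  simpa [sub_eq_add_neg] using h

lemma eq_zero_of_l1_eq_zero {z : EuclideanSpace ℝ (Fin n)} (h : l1 z = 0) : z = 0 := by
  ext i
  have := (Finset.sum_eq_zero_iff_of_nonneg fun i _ => abs_nonneg (z i)).1 h i (Finset.mem_univ i)
  simpa using this

/-- An `ℓ¹` operator bound on a net of the sphere extends to all vectors. -/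
lemma l1_map_le_of_net (G : EuclideanSpace ℝ (Fin k) →ₗ[ℝ] EuclideanSpace ℝ (Fin n))
    {ε M M' : ℝ} (hM : M + ε * M' ≤ M') (hε : ε < 1)
    {T : Finset (EuclideanSpace ℝ (Fin k))}
    (hnet : ∀ a : EuclideanSpace ℝ (Fin k), ‖a‖ = 1 → ∃ c ∈ T, ‖a - c‖ ≤ ε)
    (hT : ∀ c ∈ T, l1 (G c) ≤ M) (a : EuclideanSpace ℝ (Fin k)) : l1 (G a) ≤ M' * ‖a‖ := by
  have hcont : Continuous fun a => l1 (G a) := by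
    have := G.continuous_of_finiteDimensional
    unfold l1
    fun_prop
  have hhom (b : EuclideanSpace ℝ (Fin k)) (K : ℝ)
      (hK : ∀ a : EuclideanSpace ℝ (Fin k), ‖a‖ = 1 → l1 (G a) ≤ K) : l1 (G b) ≤ K * ‖b‖ := by
    rcases eq_or_ne b 0 with rfl | hb
    · simp [l1]
    · have hb' : 0 < ‖b‖ := norm_pos_iff.2 hb
      have h1 := hK (‖b‖⁻¹ • b) (by rw [norm_smul, norm_inv, norm_norm, inv_mul_cancel₀ hb'.ne'])
      rw [map_smul, l1_smul, abs_of_pos (by positivity)] at h1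
      rwa [inv_mul_eq_div, div_le_iff₀ hb'] at h1
  refine hhom a M' fun a ha => ?_
  -- The maximum K over the sphere is attained, and comparison with a nearby net point gives K ≤ M +
  -- εK.
  obtain ⟨b, hb, hmax⟩ := (isCompact_sphere (0 : EuclideanSpace ℝ (Fin k)) 1).exists_isMaxOn
    ⟨a, by simpa using ha⟩ hcont.continuousOn
  have hmax' : ∀ a : EuclideanSpace ℝ (Fin k), ‖a‖ = 1 → l1 (G a) ≤ l1 (G b) :=
    fun a ha => hmax (by simpa using ha)
  obtain ⟨c, hc, hbc⟩ := hnet b (by simpa using hb)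
  have h1 := hhom (b - c) _ hmax'
  have h2 := l1_add_le (G (b - c)) (G c)
  rw [← map_add, sub_add_cancel] at h2
  have h3 := mul_le_mul_of_nonneg_left hbc (l1_nonneg (G b))
  have h4 := hT c hc
  have h5 : l1 (G b) ≤ M' := by nlinarith
  exact (hmax' a ha).trans h5

/-- Lower `ℓ¹` bounds for translates by multiples of `x`, from bounds on a net. -/
lemma le_l1_map_add_smul_of_net (hn : 0 < n)
    (G : EuclideanSpace ℝ (Fin k) →ₗ[ℝ] EuclideanSpace ℝ (Fin n)) (x : EuclideanSpace ℝ (Fin n))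
    {T : Finset (EuclideanSpace ℝ (Fin k))}
    (hnet : ∀ a : EuclideanSpace ℝ (Fin k), ‖a‖ = 1 → ∃ c ∈ T, ‖a - c‖ ≤ 1 / 600)
    (hup : ∀ c ∈ T, l1 (G c) ≤ 5 * n)
    (hlow : ∀ c ∈ T, ∀ m ∈ Finset.Icc (-601 : ℤ) 601,
      3 * n / 100 ≤ l1 (G c + ((m : ℝ) * (n / 100 / l1 x)) • x))
    (a : EuclideanSpace ℝ (Fin k)) (b : ℝ) :
    n / 100 * ‖a‖ ≤ l1 (G a + b • x) := by
  have hn' : (0 : ℝ) < n := by exact_mod_cast hn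
  have hG := l1_map_le_of_net G (M' := 6 * n) (by linarith) (by norm_num) hnet hup
  have key : ∀ a : EuclideanSpace ℝ (Fin k), ‖a‖ = 1 → ∀ b : ℝ, n / 100 ≤ l1 (G a + b • x) := by
    intro a ha b
    by_contra! hcon
    -- Since ‖G a‖₁ ≤ 6n = 600 · n/100, a larger b cannot violate the bound. Hence a grid of 1203
    -- multiples of x, of `ℓ¹` spacing n/100, covers all relevant b. Moving to the net and to the
    -- grid costs n/100 each, out of 3n/100.
    have hbx : |b| * l1 x ≤ 601 * (n / 100) := by
      have h := l1_sub_le (G a + b • x) (G a)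
      rw [add_sub_cancel_left, l1_smul] at h
      have := hG a
      rw [ha] at this
      linarith
    obtain ⟨m, hm, hbm⟩ : ∃ m ∈ Finset.Icc (-601 : ℤ) 601,
        |b - m * (n / 100 / l1 x)| * l1 x ≤ n / 100 := by
      rcases (l1_nonneg x).eq_or_lt' with hx | hx
      · exact ⟨0, by simp, by rw [hx, mul_zero]; positivity⟩
      · set r : ℝ := b * l1 x / (n / 100) with hr
        have hrle : |r| ≤ 601 := by
          rw [hr, abs_div, abs_mul, abs_of_pos hx, abs_of_pos (by positivity : (0:ℝ) < n / 100),
            div_le_iff₀ (by positivity)]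
          exact hbx
        obtain ⟨h1, h2⟩ := abs_le.1 hrle
        refine ⟨⌊r⌋, Finset.mem_Icc.2 ⟨Int.le_floor.2 (by exact_mod_cast h1), ?_⟩, ?_⟩
        · exact_mod_cast (Int.floor_le r).trans h2
        · have hb : b = r * (n / 100 / l1 x) := by rw [hr]; field_simp
          have h3 : b - ⌊r⌋ * (n / 100 / l1 x) = (r - ⌊r⌋) * (n / 100 / l1 x) := by
            rw [sub_mul, ← hb]
          rw [h3, abs_mul, abs_of_pos (by positivity : (0:ℝ) < n / 100 / l1 x), mul_assoc,
            div_mul_cancel₀ _ hx.ne', abs_of_nonneg (by linarith [Int.floor_le r])]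
          nlinarith [Int.lt_floor_add_one r]
    obtain ⟨c, hc, hac⟩ := hnet a ha
    have h1 := hlow c hc m hm
    have h2 := l1_sub_le (G a + b • x) (G (a - c) + (b - m * (n / 100 / l1 x)) • x)
    have h3 := l1_add_le (G (a - c)) ((b - m * (n / 100 / l1 x)) • x)
    rw [l1_smul] at h3
    have h4 := hG (a - c)
    have h5 : G a + b • x - (G (a - c) + (b - m * (n / 100 / l1 x)) • x)
        = G c + (m * (n / 100 / l1 x)) • x := by
      rw [map_sub, sub_smul]; abel
    rw [h5] at h2
    nlinarith
  rcases eq_or_ne a 0 with rfl | ha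
  · simp [l1_nonneg]
  · have ha' : 0 < ‖a‖ := norm_pos_iff.2 ha
    have h1 := key (‖a‖⁻¹ • a) (by rw [norm_smul, norm_inv, norm_norm, inv_mul_cancel₀ ha'.ne'])
      (‖a‖⁻¹ * b)
    rw [map_smul, mul_smul, ← smul_add, l1_smul, abs_of_pos (by positivity), inv_mul_eq_div,
      le_div_iff₀ ha'] at h1
    exact h1

variable {Ω : Type*} [MeasurableSpace Ω] {P : Measure Ω} [IsProbabilityMeasure P]
  {w : Fin k → Ω → EuclideanSpace ℝ (Fin n)}

/-- Chernoff with parameters 1 and 100/3. The second bound is exp(n)(3/100)^n, and 3/100 ≤ exp(-3);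
both rates must beat the net cardinality, which is at most exp(n). -/
lemma measureReal_sum_smul_bounds_le
    (hw : ∀ j, HasLaw (w j) (stdGaussian (EuclideanSpace ℝ (Fin n))) P) (hind : iIndepFun w P)
    (c : EuclideanSpace ℝ (Fin k)) (hc : ‖c‖ = 1) (u : EuclideanSpace ℝ (Fin n)) :
    P.real {ω | 5 * (n : ℝ) ≤ l1 (∑ j, c j • w j ω)} ≤ Real.exp (-3 * n) ∧
    P.real {ω | l1 (∑ j, c j • w j ω + u) ≤ 3 * n / 100} ≤ Real.exp (-2 * n) := by
  have hlaw := hasLaw_sum_smul_stdGaussian hw hind c hc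
  have e3 : (3 / 100 : ℝ) ≤ Real.exp (-3) := by
    rw [Real.exp_neg, ← one_div, le_div_iff₀ (Real.exp_pos _),
      show (3 : ℝ) = (3 : ℕ) * 1 by norm_num, Real.exp_nat_mul]
    have := Real.exp_one_lt_d9
    have h := pow_le_pow_left₀ (Real.exp_pos 1).le this.le 3
    norm_num at h ⊢
    linarith
  have e2 : 2 * Real.exp ((1 : ℝ) ^ 2 / 2) ≤ Real.exp 2 := by
    have h1 : (2 : ℝ) ≤ Real.exp 1 := by linarith [Real.add_one_le_exp (1 : ℝ)]
    calc _ ≤ Real.exp 1 * Real.exp 1 := by gcongr; norm_num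
      _ = _ := by rw [← Real.exp_add]; norm_num
  constructor
  · have h := hlaw.measureReal_eq (p := fun x => 5 * (n : ℝ) ≤ l1 x)
      (by unfold l1; measurability)
    rw [h]
    refine (stdGaussian_real_le_sum_abs Finset.univ zero_le_one _).trans ?_
    rw [Finset.card_univ, Fintype.card_fin]
    calc _ ≤ Real.exp (-1 * (5 * n)) * (Real.exp 2) ^ n := by gcongr
      _ = _ := by rw [← Real.exp_nat_mul, ← Real.exp_add]; ring_nf
  · have h := hlaw.measureReal_eq (p := fun x => l1 (x + u) ≤ 3 * (n : ℝ) / 100)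
      (by unfold l1; measurability)
    rw [h]
    refine (stdGaussian_real_sum_abs_add_le (fun i => u i) (l := 100 / 3) (by norm_num) _).trans ?_
    calc _ ≤ Real.exp (100 / 3 * (3 * n / 100)) * (Real.exp (-3)) ^ n := by
          gcongr; exact (by norm_num : (1 / (100 / 3) : ℝ) = 3 / 100).trans_le e3
      _ = _ := by rw [← Real.exp_nat_mul, ← Real.exp_add]; ring_nf

/-- With overwhelming probability, all `ℓ¹` norms `‖∑ a j • w j + b • x‖₁` are at least
`n ‖a‖ / 100`. -/
lemma measureReal_exists_l1_lt_le (hn : 0 < n) (hk : (k : ℝ) ≤ n / 32)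
    (hw : ∀ j, HasLaw (w j) (stdGaussian (EuclideanSpace ℝ (Fin n))) P) (hind : iIndepFun w P)
    (x : EuclideanSpace ℝ (Fin n)) :
    P.real {ω | ¬ ∀ (a : EuclideanSpace ℝ (Fin k)) (b : ℝ),
      n / 100 * ‖a‖ ≤ l1 (∑ j, a j • w j ω + b • x)} ≤ 1204 * Real.exp (-n) := by
  obtain ⟨T, hT1, hTcard, hnet⟩ :=
    exists_sphere_net (E := EuclideanSpace ℝ (Fin k)) (ε := 1 / 600) (by norm_num)
  -- The net has at most 1201^k ≤ exp(8k) points, and k ≤ n/32.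
  have hcard : (T.card : ℝ) ≤ Real.exp n := by
    have h8 : (1201 : ℝ) ≤ Real.exp 8 := by
      rw [show (8 : ℝ) = (8 : ℕ) * 1 by norm_num, Real.exp_nat_mul]
      have h := pow_le_pow_left₀ (by norm_num) Real.exp_one_gt_d9.le 8
      norm_num at h ⊢
      linarith
    rw [finrank_euclideanSpace_fin] at hTcard
    calc (T.card : ℝ) ≤ 1201 ^ k := by convert hTcard using 2; norm_num
      _ ≤ (Real.exp 8) ^ k := by gcongr
      _ = Real.exp (k * 8) := by rw [← Real.exp_nat_mul]
      _ ≤ Real.exp n := Real.exp_le_exp.2 (by linarith)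
  let I := Finset.Icc (-601 : ℤ) 601
  let u : ℤ → EuclideanSpace ℝ (Fin n) := fun m => ((m : ℝ) * (n / 100 / l1 x)) • x
  have hsub : {ω | ¬ ∀ (a : EuclideanSpace ℝ (Fin k)) (b : ℝ),
      n / 100 * ‖a‖ ≤ l1 (∑ j, a j • w j ω + b • x)} ⊆
      ⋃ c ∈ T, ({ω | 5 * (n : ℝ) ≤ l1 (∑ j, c j • w j ω)} ∪
        ⋃ m ∈ I, {ω | l1 (∑ j, c j • w j ω + u m) ≤ 3 * n / 100}) := by
    intro ω hω
    by_contra hcon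
    simp only [Set.mem_iUnion, Set.mem_union, Set.mem_ofPred_eq, not_exists, not_or, not_le]
      at hcon
    let G : EuclideanSpace ℝ (Fin k) →ₗ[ℝ] EuclideanSpace ℝ (Fin n) :=
      { toFun := fun a => ∑ j, a j • w j ω
        map_add' := fun a b => by simp [add_smul, Finset.sum_add_distrib]
        map_smul' := fun r a => by simp [mul_smul, Finset.smul_sum] }
    exact hω fun a b => le_l1_map_add_smul_of_net hn G x hnet (fun c hc => (hcon c hc).1.le)
      (fun c hc m hm => ((hcon c hc).2 m hm).le) a b
  refine (measureReal_mono hsub (measure_ne_top _ _)).trans ((measureReal_biUnion_finset_le _ _).trans ?_)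
  -- One upper bound and 1203 shifted lower bounds per net point.
  calc _ ≤ ∑ c ∈ T, (1204 * Real.exp (-2 * n)) := by
        refine Finset.sum_le_sum fun c hc => ?_
        have hI : (I.card : ℝ) = 1203 := by simp [I]
        calc _ ≤ Real.exp (-3 * n) + ∑ m ∈ I, Real.exp (-2 * n) := by
              refine (measureReal_union_le _ _).trans (add_le_add ?_ ?_)
              · exact (measureReal_sum_smul_bounds_le hw hind c (hT1 c hc) 0).1
              · exact (measureReal_biUnion_finset_le _ _).trans (Finset.sum_le_sum fun m _ =>
                  (measureReal_sum_smul_bounds_le hw hind c (hT1 c hc) (u m)).2)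
          _ ≤ Real.exp (-2 * n) + 1203 * Real.exp (-2 * n) := by
              rw [Finset.sum_const, nsmul_eq_mul, hI]
              gcongr
              norm_num
          _ = _ := by ring
    _ = T.card * (1204 * Real.exp (-2 * n)) := by rw [Finset.sum_const, nsmul_eq_mul]
    _ ≤ Real.exp n * (1204 * Real.exp (-2 * n)) := by gcongr
    _ = 1204 * Real.exp (-n) := by
        rw [mul_left_comm, ← Real.exp_add]; ring_nf

end PlantedSparse

/-! ### Entry bounds, the cone condition and recovery -/

namespace PlantedSparse

variable {n k : ℕ} {Ω : Type*} [MeasurableSpace Ω] {P : Measure Ω} [IsProbabilityMeasure P]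
  {w : Fin k → Ω → EuclideanSpace ℝ (Fin n)}

/-- With high probability, all entries of the Gaussian vectors are at most `3 √(log n)`. -/
lemma measureReal_exists_abs_apply_ge_le {Ω : Type*} [MeasurableSpace Ω] {P : Measure Ω}
    {w : Fin k → Ω → EuclideanSpace ℝ (Fin n)} (hn : 2 ≤ n)
    (hw : ∀ j, HasLaw (w j) (stdGaussian (EuclideanSpace ℝ (Fin n))) P) :
    P.real {ω | ∃ j i, 3 * √(Real.log n) ≤ |w j ω i|} ≤ k / n ^ 2 := by
  have hn' : (2 : ℝ) ≤ n := by exact_mod_cast hn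
  have hn0 : (0 : ℝ) < n := by linarith
  have hlog : 0 ≤ Real.log n := Real.log_nonneg (by linarith)
  have hone (j : Fin k) (i : Fin n) :
      P.real {ω | 3 * √(Real.log n) ≤ |w j ω i|} ≤ 1 / n ^ 3 := by
    rw [(hw j).measureReal_eq (p := fun x => 3 * √(Real.log n) ≤ |x i|) (by measurability)]
    -- The optimal choice t = r gives 2n^(-9/2) ≤ n · n^(-4), using 2 ≤ n.
    have h := stdGaussian_real_le_sum_abs {i} (t := 3 * √(Real.log n)) (by positivity)
      (3 * √(Real.log n))
    simp only [Finset.sum_singleton, Finset.card_singleton, pow_one] at h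
    refine h.trans ?_
    calc _ = 2 * Real.exp (-(9 / 2) * √(Real.log n) ^ 2) := by
          rw [mul_left_comm, ← Real.exp_add]; ring_nf
      _ ≤ n * Real.exp ((4 : ℕ) * -Real.log n) := by
          rw [Real.sq_sqrt hlog]
          refine mul_le_mul hn' (Real.exp_le_exp.2 ?_) (Real.exp_pos _).le hn0.le
          push_cast
          linarith
      _ = 1 / n ^ 3 := by
          rw [Real.exp_nat_mul, Real.exp_neg, Real.exp_log hn0]
          field_simp
  have hsub : {ω | ∃ j i, 3 * √(Real.log n) ≤ |w j ω i|} =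
      ⋃ j, ⋃ i, {ω | 3 * √(Real.log n) ≤ |w j ω i|} := by
    ext ω; simp
  rw [hsub]
  calc _ ≤ ∑ j : Fin k, ∑ i : Fin n, 1 / (n : ℝ) ^ 3 :=
        (measureReal_iUnion_fintype_le _).trans (Finset.sum_le_sum fun j _ =>
          (measureReal_iUnion_fintype_le _).trans (Finset.sum_le_sum fun i _ => hone j i))
    _ = k / n ^ 2 := by
        simp
        field_simp

/-- The complementary event of an unlikely event. -/
lemma HoldsWithProbAtLeast.of_measureReal_not_le {A : Ω → Prop} {p : ℝ}
    (h : P.real {ω | ¬ A ω} ≤ 1 - p) : HoldsWithProbAtLeast P p A := by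
  -- The measurable hull of the bad event has the same outer measure.
  refine ⟨(toMeasurable P {ω | ¬ A ω})ᶜ, (measurableSet_toMeasurable _ _).compl, ?_, ?_⟩
  · rw [probReal_compl_eq_one_sub (measurableSet_toMeasurable _ _), measureReal_def,
      measure_toMeasurable, ← measureReal_def]
    linarith
  · intro ω hω
    by_contra hA
    exact hω (subset_toMeasurable P {ω | ¬ A ω} hA)

lemma HoldsWithProbAtLeast.mono {Ω : Type*} [MeasurableSpace Ω] {P : Measure Ω} 
    {A B : Ω → Prop} {p q : ℝ} (h : HoldsWithProbAtLeast P p A)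
    (hqp : q ≤ p) (hAB : ∀ ω, A ω → B ω) : HoldsWithProbAtLeast P q B :=
  let ⟨E, hE, hp, hA⟩ := h
  ⟨E, hE, hqp.trans hp, fun ω hω => hAB ω (hA ω hω)⟩

/-- The cone condition for descent directions of the `ℓ¹` norm. -/
lemma l1_le_of_l1_add_le {x h : EuclideanSpace ℝ (Fin n)} (hle : l1 (x + h) ≤ l1 x)
    (S : Finset (Fin n)) : l1 h ≤ 2 * ∑ i ∈ S, |h i| + 2 * ∑ i ∈ Sᶜ, |x i| := by
  have h1 : ∑ i ∈ S, (|x i| - |h i|) + ∑ i ∈ Sᶜ, (|h i| - |x i|) ≤ l1 (x + h) := by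
    rw [l1, ← Finset.sum_add_sum_compl S]
    refine add_le_add (Finset.sum_le_sum fun i _ => ?_) (Finset.sum_le_sum fun i _ => ?_)
    · have := abs_sub_abs_le_abs_sub (x i) (-h i)
      rwa [abs_neg, sub_neg_eq_add] at this
    · have := abs_sub_abs_le_abs_sub (h i) (-x i)
      rwa [abs_neg, sub_neg_eq_add, add_comm (h i)] at this
  have h2 : l1 x = ∑ i ∈ S, |x i| + ∑ i ∈ Sᶜ, |x i| := (Finset.sum_add_sum_compl S _).symm
  have h3 : l1 h = ∑ i ∈ S, |h i| + ∑ i ∈ Sᶜ, |h i| := (Finset.sum_add_sum_compl S _).symm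
  rw [Finset.sum_sub_distrib, Finset.sum_sub_distrib] at h1
  linarith

/-- The recovery estimate for subspaces satisfying the two deterministic conditions. -/
lemma norm_sub_le_of_isProgramMinimizer (hn : 0 < n) {Y : Fin k → EuclideanSpace ℝ (Fin n)}
    {v : EuclideanSpace ℝ (Fin n)} {i₀ : Fin n} (hv0 : v i₀ ≠ 0) (hv : ∀ i, |v i| ≤ |v i₀|)
    {t : ℝ} (ht : 0 ≤ t) (hY : ∀ j i, |Y j i| ≤ 3 * t)
    (hlow : ∀ (a : EuclideanSpace ℝ (Fin k)) (b : ℝ),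
      n / 100 * ‖a‖ ≤ l1 (∑ j, a j • Y j + b • ((v i₀)⁻¹ • v)))
    {S : Finset (Fin n)} (hS : S.card * (√k * t) ≤ n / 2400)
    {z : EuclideanSpace ℝ (Fin n)} (hz : IsProgramMinimizer (plantedSubspace v Y) i₀ z) :
    ‖z - (v i₀)⁻¹ • v‖ ≤ 2400 * (√k * t / √n) * ((∑ i ∈ Sᶜ, |v i|) / |v i₀|) := by
  have hn' : (0 : ℝ) < n := by exact_mod_cast hn
  set x := (v i₀)⁻¹ • v with hx
  set σ := (∑ i ∈ Sᶜ, |v i|) / |v i₀| with hσ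
  have hxi (i : Fin n) : |x i| = |v i| / |v i₀| := by
    simp [hx, inv_mul_eq_div, abs_div]
  have hx1 (i : Fin n) : |x i| ≤ 1 := by
    rw [hxi]; exact div_le_one_of_le₀ (hv i) (abs_nonneg _)
  have hxi₀ : x i₀ = 1 := by simp [hx, hv0]
  obtain ⟨⟨hzW, hzi⟩, hmin⟩ := hz
  have hle : l1 z ≤ l1 x :=
    hmin x (Submodule.smul_mem _ _ (Submodule.subset_span (Set.mem_insert _ _))) hxi₀
  obtain ⟨b₀, y, hy, hzy⟩ := Submodule.mem_span_insert.1 hzW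
  obtain ⟨a', rfl⟩ := (Submodule.mem_span_range_iff_exists_fun ℝ).1 hy
  let a : EuclideanSpace ℝ (Fin k) := WithLp.toLp 2 a'
  set g := ∑ j, a j • Y j with hg
  have hzg : z = g + (b₀ * v i₀) • x := by
    rw [hx, smul_smul, mul_assoc, mul_inv_cancel₀ hv0, mul_one, add_comm]
    exact hzy
  have hb : b₀ * v i₀ = 1 - g i₀ := by
    have := hzi
    rw [hzg] at this
    simp only [PiLp.add_apply, PiLp.smul_apply, smul_eq_mul, hxi₀, mul_one] at this
    linarith
  have hh : z - x = g + (-g i₀) • x := by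
    rw [hzg, hb, sub_smul, one_smul, neg_smul]; abel
  have hsum : ∑ j, |a j| ≤ √k * ‖a‖ := by
    have := Real.sum_mul_le_sqrt_mul_sqrt (Finset.univ : Finset (Fin k)) (fun _ => 1) fun j => |a j|
    rw [EuclideanSpace.norm_eq]
    simpa using this
  have hgi (i : Fin n) : |g i| ≤ 3 * (√k * t) * ‖a‖ := by
    calc |g i| = |∑ j, a j * Y j i| := by simp [hg]
      _ ≤ ∑ j, |a j| * |Y j i| := by
        simpa [abs_mul] using Finset.abs_sum_le_sum_abs (fun j => a j * Y j i) Finset.univ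
      _ ≤ ∑ j, |a j| * (3 * t) :=
        Finset.sum_le_sum fun j _ => mul_le_mul_of_nonneg_left (hY j i) (abs_nonneg _)
      _ ≤ √k * ‖a‖ * (3 * t) := by rw [← Finset.sum_mul]; gcongr
      _ = _ := by ring
  have hhi (i : Fin n) : |(z - x) i| ≤ 6 * (√k * t) * ‖a‖ := by
    have h1 : (z - x) i = g i - g i₀ * x i := by
      rw [hh]; simp [sub_eq_add_neg]
    rw [h1]
    have h2 : |g i₀ * x i| ≤ 3 * (√k * t) * ‖a‖ := by
      rw [abs_mul]
      exact (mul_le_of_le_one_right (abs_nonneg _) (hx1 i)).trans (hgi i₀)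
    linarith [abs_sub (g i) (g i₀ * x i), hgi i]
  have hcone := l1_le_of_l1_add_le (x := x) (h := z - x) (by simpa using hle) S
  have hσx : ∑ i ∈ Sᶜ, |x i| = σ := by
    rw [hσ, Finset.sum_div]; exact Finset.sum_congr rfl fun i _ => hxi i
  have hSh : ∑ i ∈ S, |(z - x) i| ≤ n / 400 * ‖a‖ := by
    calc _ ≤ ∑ i ∈ S, 6 * (√k * t) * ‖a‖ := Finset.sum_le_sum fun i _ => hhi i
      _ = 6 * (S.card * (√k * t)) * ‖a‖ := by rw [Finset.sum_const, nsmul_eq_mul]; ring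
      _ ≤ 6 * (n / 2400) * ‖a‖ := by gcongr
      _ = _ := by ring
  have hl := hlow a (-g i₀)
  rw [← hg, ← hh] at hl
  -- Here (n/100)‖a‖ ≤ 2(n/400)‖a‖ + 2σ, and the first term is absorbed.
  have ha : ‖a‖ ≤ 400 * σ / n := by
    rw [le_div_iff₀ hn']
    linarith
  calc ‖z - x‖ ≤ √n * (6 * (√k * t) * ‖a‖) := by
        rw [EuclideanSpace.norm_eq]
        refine Real.sqrt_le_iff.2 ⟨by positivity, ?_⟩
        rw [mul_pow, Real.sq_sqrt hn'.le]
        calc _ ≤ ∑ i : Fin n, (6 * (√k * t) * ‖a‖) ^ 2 :=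
              Finset.sum_le_sum fun i _ => by
                rw [Real.norm_eq_abs]; exact pow_le_pow_left₀ (abs_nonneg _) (hhi i) 2
          _ = _ := by simp
    _ ≤ √n * (6 * (√k * t) * (400 * σ / n)) := by gcongr
    _ = 2400 * (√k * t / √n) * σ := by
        have h := Real.sq_sqrt hn'.le
        have h0 : √(n : ℝ) ≠ 0 := by positivity
        field_simp
        rw [h]
        ring

/-- The recovery estimate holds with high probability, for every sufficiently small set `S` in
place of the support of a best approximation. -/
lemma holdsWithProbAtLeast_norm_sub_le (hn : 2 ≤ n) (hk : (k : ℝ) ≤ n / 32)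
    (hw : ∀ j, HasLaw (w j) (stdGaussian (EuclideanSpace ℝ (Fin n))) P) (hind : iIndepFun w P)
    {v : EuclideanSpace ℝ (Fin n)} {i₀ : Fin n} (hv0 : v ≠ 0) (hv : ∀ i, |v i| ≤ |v i₀|) :
    HoldsWithProbAtLeast P (1 - 1204 * Real.exp (-n) - k / n ^ 2) fun ω =>
      ∀ (S : Finset (Fin n)) (z : EuclideanSpace ℝ (Fin n)),
        S.card * √(k * Real.log n) ≤ n / 2400 →
        IsProgramMinimizer (plantedSubspace v fun j => w j ω) i₀ z →
        ‖z - (v i₀)⁻¹ • v‖ ≤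
          2400 * (√(k * Real.log n) / √n) * ((∑ i ∈ Sᶜ, |v i|) / |v i₀|) := by
  have hvi₀ : v i₀ ≠ 0 := fun h => hv0 <| by
    ext i
    simpa [h] using hv i
  apply HoldsWithProbAtLeast.of_measureReal_not_le
  refine (measureReal_mono (s₂ := {ω | ¬ ∀ (a : EuclideanSpace ℝ (Fin k)) (b : ℝ),
      n / 100 * ‖a‖ ≤ l1 (∑ j, a j • w j ω + b • ((v i₀)⁻¹ • v))} ∪
      {ω | ∃ j i, 3 * √(Real.log n) ≤ |w j ω i|}) ?_ (measure_ne_top _ _)).trans ?_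
  · intro ω hω
    by_contra hcon
    simp only [Set.mem_union, Set.mem_ofPred_eq, not_or, not_not, not_exists, not_le] at hcon
    refine hω fun S z hS hz => ?_
    rw [Real.sqrt_mul (Nat.cast_nonneg k)] at hS ⊢
    exact norm_sub_le_of_isProgramMinimizer (by omega) hvi₀ hv (Real.sqrt_nonneg _)
      (fun j i => (hcon.2 j i).le) hcon.1 hS hz
  · refine (measureReal_union_le _ _).trans ?_
    linarith [measureReal_exists_l1_lt_le (by omega) hk hw hind ((v i₀)⁻¹ • v),
      measureReal_exists_abs_apply_ge_le hn hw]

lemma linf_eq_abs {v : EuclideanSpace ℝ (Fin n)} {i₀ : Fin n} (hv : ∀ i, |v i| ≤ |v i₀|) :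
    linf v = |v i₀| :=
  le_antisymm ((pi_norm_le_iff_of_nonneg (abs_nonneg _)).2 hv)
    (norm_le_pi_norm (WithLp.ofLp v) i₀)

/-- A vector with at most `s` nonzero entries provides a set of at most `s` indices outside of
which the approximated vector is small. -/
lemma exists_card_le_sum_compl_le {s : ℕ} {v u : EuclideanSpace ℝ (Fin n)} (hu : l0 u ≤ s) :
    ∃ S : Finset (Fin n), S.card ≤ s ∧ ∑ i ∈ Sᶜ, |v i| ≤ l1 (v - u) := by
  classical
  refine ⟨Finset.univ.filter fun i => u i ≠ 0, ?_, ?_⟩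
  · refine le_trans (le_of_eq ?_) hu
    rw [l0, ← Set.ncard_coe_finset]
    simp
  · calc _ = ∑ i ∈ (Finset.univ.filter fun i => u i ≠ 0)ᶜ, |(v - u) i| :=
          Finset.sum_congr rfl fun i hi => by
            have : u i = 0 := by simpa using hi
            simp [this]
      _ ≤ l1 (v - u) := Finset.sum_le_univ_sum_of_nonneg fun i => abs_nonneg _

end PlantedSparse

/-! ### Choice of constants and the two sparsity regimes -/

theorem theorem2 :
    ∃ c C γ₁ γ₂ : ℝ, 0 < c ∧ 0 < C ∧ 0 < γ₁ ∧ 0 < γ₂ ∧ ∃ N : ℕ,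
      ∀ n k : ℕ, N ≤ n → 1 ≤ k → (k : ℝ) ≤ (n : ℝ) / 32 →
      ∀ (Ω : Type*) [MeasurableSpace Ω] (P : Measure Ω) [IsProbabilityMeasure P]
        (w : Fin k → Ω → EuclideanSpace ℝ (Fin n)),
        (∀ j, HasLaw (w j) (stdGaussian (EuclideanSpace ℝ (Fin n))) P) → iIndepFun w P →
      ∀ (v : EuclideanSpace ℝ (Fin n)) (istar : Fin n), v ≠ 0 → (∀ i, |v i| ≤ |v istar|) →
        -- the largest admissible sparsity level
        (∀ vs : EuclideanSpace ℝ (Fin n),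
          PlantedSparse.IsBestTermApprox
            ⌊c * ((n : ℝ) / √(Real.log n)) / √(k : ℝ)⌋₊ v vs →
          PlantedSparse.HoldsWithProbAtLeast P
            (1 - γ₁ * Real.exp (-γ₂ * n / 2)
              - k * Real.exp (-(⌊c * √((n : ℝ) / Real.log n)⌋₊ : ℝ)) - (k : ℝ) / (n : ℝ) ^ 2)
            (fun ω => ∀ z : EuclideanSpace ℝ (Fin n),
              PlantedSparse.IsProgramMinimizer
                (PlantedSparse.plantedSubspace v (fun j => w j ω)) istar z →
              ‖z - (v istar)⁻¹ • v‖ ≤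
                C * (√((k : ℝ) * Real.log n) / √(n : ℝ))
                  * (PlantedSparse.l1 (v - vs) / PlantedSparse.linf v))) ∧
        -- all smaller sparsity levels
        (∀ s : ℕ, 1 ≤ s → (s : ℝ) ≤ c * ((n : ℝ) / √(Real.log n)) / √(k : ℝ) →
          ∀ vs : EuclideanSpace ℝ (Fin n), PlantedSparse.IsBestTermApprox s v vs →
          PlantedSparse.HoldsWithProbAtLeast P
            (1 - γ₁ * Real.exp (-γ₂ * n) - k * Real.exp (-(s : ℝ)) - (k : ℝ) / (n : ℝ) ^ 2)
            (fun ω => ∀ z : EuclideanSpace ℝ (Fin n),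
              PlantedSparse.IsProgramMinimizer
                (PlantedSparse.plantedSubspace v (fun j => w j ω)) istar z →
              ‖z - (v istar)⁻¹ • v‖ ≤
                C * (√(n : ℝ) / s) * (PlantedSparse.l1 (v - vs) / PlantedSparse.linf v))) := by
  -- C = 6 · 400 comes from the entry bound and the bound on ‖a‖; c = 1/2400 makes s√(k log n) ≤
  -- n/2400; n ≥ 2 makes log n positive.
  refine ⟨1 / 2400, 2400, 1204, 1, by norm_num, by norm_num, by norm_num, by norm_num, 2, ?_⟩
  intro n k hn hk1 hk Ω _ P _ w hw hind v i₀ hv0 hv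
  have hn' : (2 : ℝ) ≤ n := by exact_mod_cast hn
  have hk' : (1 : ℝ) ≤ k := by exact_mod_cast hk1
  have hlog : 0 < Real.log n := Real.log_pos (by linarith)
  have hkL : 0 < √(k * Real.log n) := Real.sqrt_pos.2 (by positivity)
  have hcard (s : ℕ) (hs : (s : ℝ) ≤ 1 / 2400 * ((n : ℝ) / √(Real.log n)) / √(k : ℝ)) :
      s * √(k * Real.log n) ≤ n / 2400 := by
    rw [mul_div_assoc, div_div, mul_comm (√(Real.log n)),
      ← Real.sqrt_mul (Nat.cast_nonneg k), ← mul_div_assoc, le_div_iff₀ hkL] at hs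
    linarith
  have hmain := PlantedSparse.holdsWithProbAtLeast_norm_sub_le hn hk hw hind hv0 hv
  have hest (s : ℕ) (hs : (s : ℝ) ≤ 1 / 2400 * ((n : ℝ) / √(Real.log n)) / √(k : ℝ))
      (vs : EuclideanSpace ℝ (Fin n)) (hvs : PlantedSparse.IsBestTermApprox s v vs) :
      PlantedSparse.HoldsWithProbAtLeast P (1 - 1204 * Real.exp (-n) - k / n ^ 2) fun ω =>
        ∀ z : EuclideanSpace ℝ (Fin n), PlantedSparse.IsProgramMinimizer
          (PlantedSparse.plantedSubspace v fun j => w j ω) i₀ z →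
        ‖z - (v i₀)⁻¹ • v‖ ≤ 2400 * (√(k * Real.log n) / √n) *
          (PlantedSparse.l1 (v - vs) / PlantedSparse.linf v) := by
    obtain ⟨S, hScard, hS⟩ := PlantedSparse.exists_card_le_sum_compl_le (v := v) hvs.1
    refine hmain.mono le_rfl fun ω hω z hz => (hω S z ?_ hz).trans ?_
    · exact (mul_le_mul_of_nonneg_right (Nat.cast_le.2 hScard) hkL.le).trans (hcard s hs)
    · rw [PlantedSparse.linf_eq_abs hv]
      gcongr
  refine ⟨fun vs hvs => ?_, fun s hs1 hs vs hvs => ?_⟩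
  · refine (hest _ (Nat.floor_le (by positivity)) vs hvs).mono ?_ fun ω hω => hω
    have h1 : Real.exp (-n) ≤ Real.exp (-1 * n / 2) := Real.exp_le_exp.2 (by linarith)
    have h2 : 0 ≤ k * Real.exp (-(⌊1 / 2400 * √((n : ℝ) / Real.log n)⌋₊ : ℝ)) := by positivity
    linarith
  · refine (hest s hs vs hvs).mono ?_ fun ω hω z hz => (hω z hz).trans ?_
    · have h2 : 0 ≤ k * Real.exp (-(s : ℝ)) := by positivity
      rw [neg_one_mul]
      linarith
    · have hs0 : (0 : ℝ) < s := by exact_mod_cast hs1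
      have hl : 0 ≤ PlantedSparse.l1 (v - vs) / PlantedSparse.linf v :=
        div_nonneg (PlantedSparse.l1_nonneg _) (norm_nonneg _)
      refine mul_le_mul_of_nonneg_right (mul_le_mul_of_nonneg_left ?_ (by norm_num)) hl
      rw [div_le_div_iff₀ (by positivity) hs0, Real.mul_self_sqrt (by positivity)]
      linarith [hcard s hs]
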